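/- Let $M$ be a matroid of rank $r$ on the ground set $[n]=\{1,\dots,n\}$ with set of bases $\mathcal B$, and let $H$ be a stressed hyperplane of $M$ with $|H|=s$; that is, $H$ is a flat of rank $r-1$ and every subset of $H$ of cardinality $r-1$ is independent. Let $\mathrm{Rel}_H(M)$ be the relaxation of $M$ at $H$, the matroid on $[n]$ whose set of bases is $\mathcal B\cup\binom{H}{r}$, where $\binom Hr$ is the set of all $r$-element subsets of $H$. For a matroid $N$ on $[n]$ let $\mathcal P_N\subset\mathbb R^n$ be its base polytope, the convex hull of the indicator vectors of its bases, and let $\mathrm{ehr}_N(t)=|t\mathcal P_N\cap\mathbb Z^n|$ $(t=0,1,2,\dots)$, which is a polynomial in $t$, the Ehrhart polynomial of $\mathcal P_N$. Then $$\mathrm{ehr}_{\mathrm{Rel}_H(M)}(t)=\mathrm{ehr}_M(t)+\frac{n-s}{(n-1)!}\binom{t-1+n-s}{n-s}\,\tilde\phi_{r,s,n}(t),$$ both for every integer $t\ge 0$ and as an identity between polynomials in $t$, where $$\tilde\phi_{r,s,n}(t)=\sum_{i=0}^{s-r}(-1)^i\binom{s}{i}\sum_{\ell=0}^{s-1}(n-2-\ell)!\,\ell!\binom{s-2-\ell-i+t(s-r-i+1)}{s-1-\ell}\binom{s-1-i+t(s-r-i)}{\ell}.$$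 Here $\binom{x}{k}=x(x-1)\cdots(x-k+1)/k!$ for $k\ge 0$, so that binomial coefficients whose upper entry involves $t$ are polynomials in $t$, and a sum whose upper limit is smaller than its lower limit is $0$. -/

import Mathlib

open Polynomial
open scoped Pointwise Nat

namespace Matroid

/-- A hyperplane of `M`: a flat whose rank is one less than the rank of `M`. -/
def IsHyperplane {α : Type*} (M : Matroid α) (H : Set α) : Prop :=
  M.IsFlat H ∧ M.eRk H + 1 = M.eRank

/-- A stressed hyperplane of `M`: a hyperplane all of whose subsets of cardinality
`rank M - 1` are independent. -/
def IsStressedHyperplane {α : Type*} (M : Matroid α) (H : Set α) : Prop :=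
  M.IsHyperplane H ∧ ∀ I ⊆ H, I.encard + 1 = M.eRank → M.Indep I

/-- Membership in `𝓑 ∪ (S choose r)`, where `𝓑` is the set of bases of `M` and `r` its rank. -/
def RelaxedIsBase {α : Type*} (M : Matroid α) (S B : Set α) : Prop :=
  M.IsBase B ∨ (B ⊆ S ∧ B.encard = M.eRank)

/-- `S` can be relaxed in `M`: no subset of `S` of cardinality `rank M` is a basis, and
`𝓑 ∪ (S choose r)` satisfies the basis exchange axiom (it is always nonempty). -/
def CanBeRelaxed {α : Type*} (M : Matroid α) (S : Set α) : Prop :=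
  S ⊆ M.E ∧ (∀ B ⊆ S, B.encard = M.eRank → ¬ M.IsBase B) ∧ ExchangeProperty (M.RelaxedIsBase S)

/-- The relaxation of `M` at `S`: the matroid on the same ground set whose
bases are the bases of `M` together with all subsets of `S` of cardinality `rank M`. -/
def relaxation {α : Type*} (M : Matroid α) [M.Finite] (S : Set α) (hS : M.CanBeRelaxed S) :
    Matroid α :=
  Matroid.ofIsBaseOfFinite M.ground_finite (M.RelaxedIsBase S)
    (M.exists_isBase.imp fun _ hB => Or.inl hB) hS.2.2
    (fun _ hB => hB.elim (fun h => h.subset_ground) (fun h => h.1.trans hS.1))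

theorem relaxation_isBase_iff {α : Type*} (M : Matroid α) [M.Finite] (S : Set α)
    (hS : M.CanBeRelaxed S) (B : Set α) :
    (M.relaxation S hS).IsBase B ↔ M.IsBase B ∨ (B ⊆ S ∧ B.encard = M.eRank) := Iff.rfl

theorem relaxation_ground {α : Type*} (M : Matroid α) [M.Finite] (S : Set α)
    (hS : M.CanBeRelaxed S) : (M.relaxation S hS).E = M.E := rfl

/-- A stressed hyperplane can be relaxed. -/
theorem IsStressedHyperplane.canBeRelaxed {α : Type*} {M : Matroid α} [M.Finite] {H : Set α}
    (hH : M.IsStressedHyperplane H) : M.CanBeRelaxed H := by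
  obtain ⟨⟨hflat, hrk⟩, hst⟩ := hH
  have hfin : M.eRank ≠ ⊤ := by
    obtain ⟨B, hB⟩ := M.exists_isBase
    rw [← hB.encard_eq_eRank]
    exact Set.encard_ne_top_iff.2 hB.finite
  have hHfin : M.eRk H ≠ ⊤ := fun h => hfin (by rw [← hrk, h]; rfl)
  have hnot : ∀ B ⊆ H, B.encard = M.eRank → ¬ M.IsBase B := by
    intro B hBH hc hB
    have h1 := M.eRk_mono hBH
    rw [hB.indep.eRk_eq_encard, hc, ← hrk] at h1
    exact (ENat.add_one_le_iff hHfin).1 h1 |>.ne rfl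
  -- every relaxed base has cardinality the rank
  have hcard : ∀ X, M.RelaxedIsBase H X → X.encard = M.eRank := by
    rintro X (hX | hX)
    · exact hX.encard_eq_eRank
    · exact hX.2
  have hbase : ∀ I b, M.Indep I → I.encard + 1 = M.eRank → b ∉ I → M.Indep (insert b I) →
      M.IsBase (insert b I) := by
    intro I b _ hI hb hind
    obtain ⟨B, hB, hIB⟩ := hind.exists_isBase_superset
    have : insert b I = B := by
      refine (hB.finite.subset hIB).eq_of_subset_of_encard_le hIB ?_
      rw [hB.encard_eq_eRank, Set.encard_insert_of_notMem hb, hI]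
    rwa [this]
  refine ⟨hflat.subset_ground, hnot, ?_⟩
  intro X Y hX hY a ha
  have hXa : (X \ {a}).encard + 1 = M.eRank := by
    rw [Set.encard_sdiff_singleton_add_one ha.1, hcard X hX]
  have hlt : (X \ {a}).encard < Y.encard := by
    rw [hcard Y hY, ← hXa]
    refine (ENat.lt_add_one_iff ?_).2 le_rfl
    intro h; rw [h] at hXa; exact hfin (by rw [← hXa]; rfl)
  have hinH : X \ {a} ⊆ H → Y ⊆ H → ∃ b ∈ Y \ X, M.RelaxedIsBase H (insert b (X \ {a})) := by
    intro h1 h2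
    obtain ⟨b, hbY, hb⟩ : ∃ b ∈ Y, b ∉ X \ {a} := by
      by_contra! hcon
      exact absurd (Set.encard_le_encard (show Y ⊆ X \ {a} from hcon)) (not_le.2 hlt)
    have hbX : b ∉ X := fun h => hb ⟨h, fun h' => ha.2 (by rw [← h']; exact hbY)⟩
    refine ⟨b, ⟨hbY, hbX⟩, Or.inr ⟨Set.insert_subset (h2 hbY) h1, ?_⟩⟩
    rw [Set.encard_insert_of_notMem hb, hXa]
  have hofbase : M.Indep (X \ {a}) → (∃ b ∈ Y, b ∉ X \ {a} ∧ M.Indep (insert b (X \ {a}))) →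
      ∃ b ∈ Y \ X, M.RelaxedIsBase H (insert b (X \ {a})) := by
    rintro hI ⟨b, hbY, hb, hind⟩
    have hbX : b ∉ X := fun h => hb ⟨h, fun h' => ha.2 (by rw [← h']; exact hbY)⟩
    exact ⟨b, ⟨hbY, hbX⟩, Or.inl (hbase _ b hI hXa hb hind)⟩
  rcases hX with hX | ⟨hXH, hXc⟩
  · rcases hY with hY | ⟨hYH, hYc⟩
    · obtain ⟨b, hb, hb'⟩ := hX.exchange hY ha
      exact ⟨b, hb, Or.inl hb'⟩
    · have hI : M.Indep (X \ {a}) := hX.indep.subset Set.sdiff_subset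
      by_cases hsub : X \ {a} ⊆ H
      · exact hinH hsub hYH
      refine hofbase hI ?_
      by_contra! hcon
      have hYcl : Y ⊆ M.closure (X \ {a}) := by
        intro y hy
        rw [hI.mem_closure_iff']
        exact ⟨hflat.subset_ground (hYH hy), fun hi => by
          by_contra hn; exact hcon y hy hn hi⟩
      obtain ⟨y, hy⟩ : Y.Nonempty := by
        rw [← Set.encard_pos]; exact lt_of_le_of_lt zero_le hlt
      have hJc : (Y \ {y}).encard + 1 = M.eRank := by
        rw [Set.encard_sdiff_singleton_add_one hy, hYc]
      have hJ : M.Indep (Y \ {y}) := hst _ (Set.sdiff_subset.trans hYH) hJc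
      have hle : M.eRk (M.closure (X \ {a})) ≤ M.eRk (Y \ {y}) := by
        rw [eRk_closure_eq, hI.eRk_eq_encard, hJ.eRk_eq_encard]
        have := hXa.trans hJc.symm
        exact ((ENat.add_left_injective_of_ne_top ENat.one_ne_top) this).le
      have := IsRkFinite.closure_eq_closure_of_subset_of_eRk_ge_eRk
        (M.isRkFinite_set (Y \ {y})) (Set.sdiff_subset.trans hYcl) hle
      rw [closure_closure] at this
      apply hsub
      calc X \ {a} ⊆ M.closure (X \ {a}) := M.subset_closure _ hI.subset_ground
        _ = M.closure (Y \ {y}) := this.symm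
        _ ⊆ M.closure H := M.closure_subset_closure (Set.sdiff_subset.trans hYH)
        _ = H := hflat.closure
  · rcases hY with hY | ⟨hYH, hYc⟩
    · have hI : M.Indep (X \ {a}) := hst _ (Set.sdiff_subset.trans hXH) hXa
      refine hofbase hI ?_
      have hnb : ¬ M.IsBase (X \ {a}) := fun h => by
        rw [h.encard_eq_eRank, ← hY.encard_eq_eRank] at hlt
        exact lt_irrefl _ hlt
      obtain ⟨b, hb, hb'⟩ := hI.exists_insert_of_not_isBase hnb hY
      exact ⟨b, hb.1, hb.2, hb'⟩
    · exact hinH (Set.sdiff_subset.trans hXH) hYH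

/-- The base polytope of `M`: the convex hull of the indicator vectors of its bases. -/
def basePolytope {α : Type*} (M : Matroid α) : Set (α → ℝ) :=
  convexHull ℝ {x | ∃ B, M.IsBase B ∧ x = B.indicator 1}

end Matroid

/-- The Ehrhart function `t ↦ |tP ∩ ℤ^ι|` of a polytope `P ⊆ ℝ^ι`. -/
noncomputable def ehrhartFunction {ι : Type*} (P : Set (ι → ℝ)) (t : ℕ) : ℕ :=
  {z : ι → ℤ | (fun i => (z i : ℝ)) ∈ (t : ℝ) • P}.ncard

/-- `p` is the Ehrhart polynomial of `P`: its values at the nonnegative integers are those of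
the Ehrhart function (so there is at most one such `p`). -/
def IsEhrhartPolynomial {ι : Type*} (P : Set (ι → ℝ)) (p : ℚ[X]) : Prop :=
  ∀ t : ℕ, p.eval (t : ℚ) = ehrhartFunction P t

/-- The binomial coefficient `p choose k = p (p - 1) ⋯ (p - k + 1) / k!` of a polynomial `p`. -/
noncomputable def polyChoose (p : ℚ[X]) (k : ℕ) : ℚ[X] :=
  C ((k ! : ℚ)⁻¹) * ∏ j ∈ Finset.range k, (p - (j : ℚ[X]))

/-- The polynomial `φ̃_{r,s,n}(t)`, with `t = X`. The outer sum runs over `0 ≤ i ≤ s - r`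
(it is empty if `s < r`), the inner one over `0 ≤ ℓ ≤ s - 1`. -/
noncomputable def phiTilde (r s n : ℕ) : ℚ[X] :=
  ∑ i ∈ Finset.range (s + 1 - r), (-1) ^ i * (s.choose i : ℚ[X]) *
    ∑ l ∈ Finset.range s, ((n - 2 - l)! : ℚ[X]) * (l ! : ℚ[X]) *
      polyChoose ((s : ℚ[X]) - 2 - (l : ℚ[X]) - (i : ℚ[X])
        + X * ((s : ℚ[X]) - (r : ℚ[X]) - (i : ℚ[X]) + 1)) (s - 1 - l) *
      polyChoose ((s : ℚ[X]) - 1 - (i : ℚ[X])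
        + X * ((s : ℚ[X]) - (r : ℚ[X]) - (i : ℚ[X]))) l

/-! Write F for H and x(F) for the sum of the coordinates in F. A basis of M has at most r - 1
elements in F, so x(F) ≤ r - 1 on the polytope of M. The heart of the matter is the converse: this
single inequality cuts the polytope of M out of that of the relaxation
(`IsStressedHyperplane.mem_basePolytope_of_sum_le`, by separation and basis exchange). As the total
weight is tr, a lattice point gained in the t-th dilate has weight less than t outside F.
Conversely, every integral z ≥ 0 with z_i ≤ t on F, total tr and weight at most t outside F is a sum
of t basis indicators of the relaxation (`IsStressedHyperplane.mem_smul_basePolytope`), because for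
any e ∉ F all r-subsets of F ∪ {e} are bases there.

The rest is counting. Replacing z_i by t - z_i on F turns the gained points into pairs (y, w): w ∈
ℕ^(n-s) has sum j < t, and y ∈ {0, …, t}^s has sum t(s - r) + j. For fixed j the vectors w are
counted by one binomial coefficient and the vectors y by inclusion-exclusion
(`card_filter_sum_eq_of_lt`). The sum over j is evaluated by `sum_choose_mul_choose`, the source of
the inner sum with factorials in `phiTilde`. -/

/-! ### Binomial coefficients with rational upper entry and a summation identity. -/

theorem polyChoose_eval (p : ℚ[X]) (k : ℕ) (x : ℚ) :
    (polyChoose p k).eval x = Ring.choose (p.eval x) k := by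
  rw [Ring.choose_eq_smul, polyChoose, ← Polynomial.aeval_eq_smeval, Polynomial.aeval_def,
    ← Polynomial.eval_map, descPochhammer_map, descPochhammer_eval_eq_prod_range]
  simp [eval_prod]

theorem Ring.succ_mul_choose_succ (x : ℚ) (k : ℕ) :
    ((k : ℚ) + 1) * Ring.choose x (k + 1) = x * Ring.choose (x - 1) k := by
  have h := Ring.choose_smul_choose x (n := k + 1) (k := 1) (by omega)
  simpa using h

theorem Ring.succ_mul_choose_succ' (x : ℚ) (k : ℕ) :
    ((k : ℚ) + 1) * Ring.choose x (k + 1) = (x - k) * Ring.choose x k := by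
  have h := Ring.choose_smul_choose x (n := k + 1) (k := k) (by omega)
  rw [mul_comm (x - k)]
  simpa using h

theorem Ring.choose_succ_eq_add (x : ℚ) (k : ℕ) :
    Ring.choose x (k + 1) = Ring.choose (x - 1) k + Ring.choose (x - 1) (k + 1) := by
  have h := Ring.choose_succ_succ (x - 1) k
  rwa [sub_add_cancel] at h

/-- Partial sums of the telescoping sum behind `sum_factorial_mul_choose_mul_choose`. -/
theorem sum_factorial_mul_choose_mul_choose_of_le (p t : ℚ) (m k L : ℕ) (hL : L ≤ k) :
    ∑ l ∈ Finset.range L, ((m + k - l)! : ℚ) * (l ! : ℚ) * Ring.choose p l *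
      ((t + (m + 1)) * Ring.choose (p + t - l) (k - l) -
        t * Ring.choose (p + t - 1 - l) (k - l)) =
      ((m + 1 + k)! : ℚ) * Ring.choose (p + t) k -
        ((m + 1 + k - L)! : ℚ) * (L ! : ℚ) * Ring.choose p L *
          Ring.choose (p + t - L) (k - L) := by
  induction L with
  | zero => simp
  | succ L ih =>
    rw [Finset.sum_range_succ, ih (by omega)]
    obtain ⟨K, rfl⟩ : ∃ K, k = L + 1 + K := ⟨k - (L + 1), by omega⟩
    rw [show L + 1 + K - L = K + 1 by omega, show L + 1 + K - (L + 1) = K by omega,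
      show m + (L + 1 + K) - L = m + K + 1 by omega,
      show m + 1 + (L + 1 + K) - L = m + K + 1 + 1 by omega,
      show m + 1 + (L + 1 + K) - (L + 1) = m + K + 1 by omega,
      Nat.factorial_succ (m + K + 1), Nat.factorial_succ L]
    -- Absorption (`h1`, `h2`) and Pascal's rule (`h3`) show that the summand at `L` is the drop of
    -- the subtracted product from `L` to `L + 1`.
    have h1 := Ring.succ_mul_choose_succ (p + t - L) K
    have h2 := Ring.succ_mul_choose_succ' p L
    have h3 := Ring.choose_succ_eq_add (p + t - L) K
    rw [show p + t - 1 - L = p + t - L - 1 by ring,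
      show p + t - ((L + 1 : ℕ) : ℚ) = p + t - L - 1 by push_cast; ring]
    generalize Ring.choose (p + t - L) (K + 1) = a at *
    generalize Ring.choose (p + t - L - 1) (K + 1) = b at *
    generalize Ring.choose (p + t - L - 1) K = c at *
    generalize Ring.choose p (L + 1) = d at *
    generalize Ring.choose p L = e at *
    obtain rfl : b = a - c := by linarith
    push_cast
    linear_combination (-((m + K + 1)! : ℚ) * (L ! : ℚ) * e) * h1 +
      ((m + K + 1)! : ℚ) * (L ! : ℚ) * c * h2

theorem sum_factorial_mul_choose_mul_choose (p t : ℚ) (m k : ℕ) :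
    ∑ l ∈ Finset.range (k + 1), ((m + k - l)! : ℚ) * (l ! : ℚ) * Ring.choose p l *
      ((t + (m + 1)) * Ring.choose (p + t - l) (k - l) -
        t * Ring.choose (p + t - 1 - l) (k - l)) =
      ((m + 1 + k)! : ℚ) * Ring.choose (p + t) k := by
  -- The telescoping stops at `L = k`, where `k - L` would begin to truncate. The last summand has
  -- both inner binomials equal to 1 and cancels the remainder.
  rw [Finset.sum_range_succ, sum_factorial_mul_choose_mul_choose_of_le p t m k k le_rfl,
    show m + k - k = m by omega, show m + 1 + k - k = m + 1 by omega, Nat.factorial_succ m]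
  simp only [Nat.sub_self, Ring.choose_zero_right]
  push_cast
  ring

/-- Induction on `t`. Absorption turns the prefactor at `t` and at `t + 1` into `t` and `t + m + 1`
times the same binomial coefficient, so the increment of the right side is the sum evaluated in
`sum_factorial_mul_choose_mul_choose`. -/
theorem sum_choose_mul_choose (p : ℚ) (m k t : ℕ) :
    ((m + 1 + k)! : ℚ) * ∑ j ∈ Finset.range t,
      ((j + m).choose m : ℚ) * Ring.choose (p + j) k =
    ((m : ℚ) + 1) * Ring.choose ((t : ℚ) + m) (m + 1) *
      ∑ l ∈ Finset.range (k + 1), ((m + k - l)! : ℚ) * (l ! : ℚ) *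
        Ring.choose (p + t - 1 - l) (k - l) * Ring.choose p l := by
  induction t with
  | zero =>
    have : Ring.choose (((0 : ℕ) : ℚ) + m) (m + 1) = 0 := by
      rw [Nat.cast_zero, zero_add, Ring.choose_natCast, Nat.choose_succ_self, Nat.cast_zero]
    rw [this]; simp
  | succ t ih =>
    rw [Finset.sum_range_succ, mul_add, ih]
    have key := sum_factorial_mul_choose_mul_choose p t m k
    have h1 := Ring.succ_mul_choose_succ' ((t : ℚ) + m) m
    have h2 := Ring.succ_mul_choose_succ ((t : ℚ) + m + 1) m
    have h3 : Ring.choose ((t : ℚ) + m) m = ((t + m).choose m : ℚ) := by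
      rw [← Nat.cast_add, Ring.choose_natCast]
    rw [add_sub_cancel_right, h3] at h2
    rw [add_sub_cancel_right, h3] at h1
    rw [h1, show ((t + 1 : ℕ) : ℚ) + m = t + m + 1 by push_cast; ring, h2]
    have e : ∀ l : ℕ, p + ((t + 1 : ℕ) : ℚ) - 1 - l = p + t - l := by
      intro l; push_cast; ring
    simp only [e]
    rw [show ((m + 1 + k)! : ℚ) * (((t + m).choose m : ℚ) * Ring.choose (p + t) k) =
      ((t + m).choose m : ℚ) * (((m + 1 + k)! : ℚ) * Ring.choose (p + t) k) by ring, ← key]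
    simp only [Finset.mul_sum, ← Finset.sum_add_distrib]
    refine Finset.sum_congr rfl fun l _ => ?_
    ring

/-! ### Counting vectors with bounded coordinates and given sum. -/

/-- The number of vectors in `{0, …, t}^ι` with coordinate sum `N`. -/
theorem card_filter_sum_eq {ι : Type*} [Fintype ι] [DecidableEq ι] {d : ℕ}
    (hd : Fintype.card ι = d + 1) (t N : ℕ) :
    (((Fintype.piFinset fun _ : ι => Finset.range (t + 1)).filter
      fun y => ∑ i, y i = N).card : ℚ) =
    ∑ i ∈ Finset.range (d + 2), (-1) ^ i * ((d + 1).choose i : ℚ) *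
      if (t + 1) * i ≤ N then ((d + (N - (t + 1) * i)).choose d : ℚ) else 0 := by
  -- The count is the coefficient of `X ^ N` in (1 + X + ⋯ + X^t)^(d+1) = (1 - X^(t+1))^(d+1) (1 -
  -- X)^(-(d+1)).
  have h1 : (∑ k ∈ Finset.range (t + 1), (PowerSeries.X : PowerSeries ℚ) ^ k) ^ (d + 1) =
      ∑ y ∈ Fintype.piFinset fun _ : ι => Finset.range (t + 1), PowerSeries.X ^ (∑ i, y i) := by
    have := Finset.prod_univ_sum (fun _ : ι => Finset.range (t + 1))
      (fun _ k => (PowerSeries.X : PowerSeries ℚ) ^ k)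
    simp only [Finset.prod_const, Finset.card_univ, hd, Finset.prod_pow_eq_pow_sum] at this
    exact this
  have h2 : (∑ k ∈ Finset.range (t + 1), (PowerSeries.X : PowerSeries ℚ) ^ k) ^ (d + 1) =
      (1 - PowerSeries.X ^ (t + 1)) ^ (d + 1) *
        PowerSeries.mk fun n ↦ (Nat.choose (d + n) d : ℚ) := by
    rw [← geom_sum_mul_neg, mul_pow, mul_assoc, mul_comm ((1 - PowerSeries.X) ^ (d + 1)),
      PowerSeries.mk_add_choose_mul_one_sub_pow_eq_one, mul_one]
  have h3 := congrArg (PowerSeries.coeff N) (h1.symm.trans h2)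
  rw [map_sum] at h3
  simp only [PowerSeries.coeff_X_pow] at h3
  rw [Finset.sum_boole] at h3
  simp only [eq_comm (a := N)] at h3
  rw [h3, sub_eq_neg_add, add_pow, Finset.sum_mul, map_sum]
  refine Finset.sum_congr rfl fun i _ => ?_
  have : ((-(PowerSeries.X : PowerSeries ℚ) ^ (t + 1)) ^ i * 1 ^ (d + 1 - i) *
      ((d + 1).choose i : PowerSeries ℚ)) * (PowerSeries.mk fun n ↦ (Nat.choose (d + n) d : ℚ)) =
      PowerSeries.C ((-1) ^ i * ((d + 1).choose i : ℚ)) * (PowerSeries.X ^ ((t + 1) * i) *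
        PowerSeries.mk fun n ↦ (Nat.choose (d + n) d : ℚ)) := by
    rw [neg_pow, pow_mul]
    simp only [map_mul, map_pow, map_neg, map_one, map_natCast]
    ring
  rw [this, PowerSeries.coeff_C_mul, PowerSeries.coeff_X_pow_mul']
  simp

/-- The number of vectors in `ℕ^κ` with coordinate sum `j`. -/
theorem card_filter_sum_eq_self {κ : Type*} [Fintype κ] [DecidableEq κ] {m : ℕ}
    (hm : Fintype.card κ = m + 1) (j : ℕ) :
    (((Fintype.piFinset fun _ : κ => Finset.range (j + 1)).filter
      fun y => ∑ i, y i = j).card : ℚ) = ((j + m).choose m : ℚ) := by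
  rw [card_filter_sum_eq hm, Finset.sum_eq_single 0]
  · simp [add_comm]
  · intro i _ hi
    rw [if_neg, mul_zero]
    have : 1 ≤ i := by omega
    nlinarith
  · simp

/-- In the range needed for the relaxation, the alternating sum may be cut off at `d + 1 - r`. -/
theorem card_filter_sum_eq_of_lt {ι : Type*} [Fintype ι] [DecidableEq ι] {d r t j : ℕ}
    (hd : Fintype.card ι = d + 1) (hr : 1 ≤ r) (hrd : r ≤ d + 1) (hj : j < t) :
    (((Fintype.piFinset fun _ : ι => Finset.range (t + 1)).filter
      fun y => ∑ i, y i = t * (d + 1 - r) + j).card : ℚ) =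
    ∑ i ∈ Finset.range (d + 2 - r), (-1) ^ i * ((d + 1).choose i : ℚ) *
      Ring.choose ((d : ℚ) - i + t * (d + 1 - r - i) + j) d := by
  rw [card_filter_sum_eq hd]
  -- For i > d + 1 - r the bound j < t gives (t + 1) i > t (d + 1 - r) + j, so these terms vanish.
  refine (Finset.sum_subset_zero_on_sdiff (Finset.range_mono (by omega)) ?_ ?_).symm
  · intro i hi
    simp only [Finset.mem_sdiff, Finset.mem_range] at hi
    rw [if_neg, mul_zero]
    obtain ⟨c, rfl⟩ : ∃ c, i = d + 1 - r + 1 + c := ⟨i - (d + 1 - r + 1), by omega⟩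
    generalize d + 1 - r = e
    nlinarith
  · intro i hi
    simp only [Finset.mem_range] at hi
    obtain ⟨e, he⟩ : ∃ e, d + 1 = r + i + e := ⟨d + 1 - r - i, by omega⟩
    -- Since r ≥ 1, the index satisfies i ≤ d and the upper entry is a natural number.
    have hc : (d : ℚ) - i + t * (d + 1 - r - i) + j = ((d - i + t * e + j : ℕ) : ℚ) := by
      have : (d : ℚ) + 1 = r + i + e := by exact_mod_cast he
      push_cast [show i ≤ d by omega]
      rw [this]; ring
    rw [hc, Ring.choose_natCast]
    congr 1
    have h4 : t * (d + 1 - r) + j = t * i + t * e + j := by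
      rw [show d + 1 - r = i + e by omega]; ring
    have h5 : (t + 1) * i = t * i + i := by ring
    split_ifs with h
    · congr 2
      rw [h4, h5] at h ⊢
      omega
    -- Here i > t e + j, so the upper entry lies in [0, d) and the polynomial expression vanishes as
    -- well.
    · rw [Nat.choose_eq_zero_of_lt, Nat.cast_zero]
      rw [h4, h5] at h
      omega

/-- The number of pairs `(y, w)` in `{0, …, t}^ι × ℕ^κ` such that the coordinate sum of `w` is
less than `t` and that of `y` exceeds it by `t * (|ι| - r)`. -/
theorem card_filter_pairs {ι κ : Type*} [Fintype ι] [DecidableEq ι] [Fintype κ] [DecidableEq κ]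
    {d m r : ℕ} (hd : Fintype.card ι = d + 1) (hm : Fintype.card κ = m + 1)
    (hr : 1 ≤ r) (hrd : r ≤ d + 1) (t : ℕ) :
    ((((Fintype.piFinset fun _ : ι => Finset.range (t + 1)) ×ˢ
      (Fintype.piFinset fun _ : κ => Finset.range t)).filter fun p =>
        ∑ i, p.2 i < t ∧ ∑ i, p.1 i = t * (d + 1 - r) + ∑ i, p.2 i).card : ℚ) =
    ((m : ℚ) + 1) / ((m + 1 + d)! : ℚ) * Ring.choose ((t : ℚ) + m) (m + 1) *
      ∑ i ∈ Finset.range (d + 2 - r), (-1) ^ i * ((d + 1).choose i : ℚ) *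
        ∑ l ∈ Finset.range (d + 1), ((m + d - l)! : ℚ) * (l ! : ℚ) *
          Ring.choose ((d : ℚ) - i + t * (d + 1 - r - i) + t - 1 - l) (d - l) *
          Ring.choose ((d : ℚ) - i + t * (d + 1 - r - i)) l := by
  rw [Finset.card_eq_sum_card_fiberwise (f := fun p => ∑ i, p.2 i) (t := Finset.range t)
    (fun p hp => by simpa using (Finset.mem_filter.1 hp).2.1)]
  have h1 : ∀ j ∈ Finset.range t, ((((((Fintype.piFinset fun _ : ι => Finset.range (t + 1)) ×ˢ
      (Fintype.piFinset fun _ : κ => Finset.range t)).filter fun p =>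
        ∑ i, p.2 i < t ∧ ∑ i, p.1 i = t * (d + 1 - r) + ∑ i, p.2 i)).filter
          fun p => ∑ i, p.2 i = j).card : ℚ) =
      ∑ i ∈ Finset.range (d + 2 - r), (-1) ^ i * ((d + 1).choose i : ℚ) *
        (((j + m).choose m : ℚ) * Ring.choose ((d : ℚ) - i + t * (d + 1 - r - i) + j) d) := by
    intro j hj
    rw [Finset.mem_range] at hj
    trans ((((Fintype.piFinset fun _ : ι => Finset.range (t + 1)).filter
      fun y => ∑ i, y i = t * (d + 1 - r) + j) ×ˢ
        ((Fintype.piFinset fun _ : κ => Finset.range (j + 1)).filter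
      fun y => ∑ i, y i = j)).card : ℚ)
    · congr 2
      ext ⟨y, w⟩
      simp only [Finset.mem_filter, Finset.mem_product, Fintype.mem_piFinset, Finset.mem_range]
      constructor
      · rintro ⟨⟨⟨hy, hw⟩, h1, h2⟩, h3⟩
        refine ⟨⟨hy, by rw [h2, h3]⟩, fun a => ?_, h3⟩
        have := Finset.single_le_sum (f := w) (fun _ _ => Nat.zero_le _) (Finset.mem_univ a)
        omega
      · rintro ⟨⟨hy, h1⟩, hw, h2⟩
        exact ⟨⟨⟨hy, fun a => by have := hw a; omega⟩, by omega, by omega⟩, h2⟩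
    · rw [Finset.card_product, Nat.cast_mul, card_filter_sum_eq_of_lt hd hr hrd hj,
        card_filter_sum_eq_self hm, Finset.sum_mul]
      exact Finset.sum_congr rfl fun i _ => by ring
  rw [Nat.cast_sum, Finset.sum_congr rfl h1, Finset.sum_comm, Finset.mul_sum]
  refine Finset.sum_congr rfl fun i _ => ?_
  have h2 := sum_choose_mul_choose ((d : ℚ) - i + t * (d + 1 - r - i)) m d t
  have h3 : ((m + 1 + d)! : ℚ) ≠ 0 := Nat.cast_ne_zero.2 (Nat.factorial_ne_zero _)
  rw [← Finset.mul_sum, eq_div_of_mul_eq h3 ((mul_comm _ _).trans h2)]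
  field_simp

/-! ### Bases obtained from a stressed hyperplane. -/

namespace Matroid

section Relaxation

variable {α : Type*} {M : Matroid α}

/-- The set `A` is independent of the same rank as the flat `H`, so its closure is `H`, and any `e`
off `H` extends it. -/
theorem IsStressedHyperplane.isBase_insert [M.Finite] {H A : Set α}
    (hH : M.IsStressedHyperplane H) (hA : A ⊆ H) (hc : A.encard + 1 = M.eRank) {e : α}
    (heE : e ∈ M.E) (he : e ∉ H) : M.IsBase (insert e A) := by
  obtain ⟨⟨hflat, hrk⟩, hst⟩ := hH
  have hI := hst A hA hc
  have hcl : M.closure A = M.closure H := by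
    refine IsRkFinite.closure_eq_closure_of_subset_of_eRk_ge_eRk (M.isRkFinite_set A) hA ?_
    rw [hI.eRk_eq_encard]
    exact ((ENat.add_left_injective_of_ne_top ENat.one_ne_top) (hrk.trans hc.symm)).le
  have heA : e ∉ A := fun h => he (hA h)
  have hind : M.Indep (insert e A) := by
    rw [hI.insert_indep_iff_of_notMem heA, hcl, hflat.closure]
    exact ⟨heE, he⟩
  obtain ⟨B, hB, hIB⟩ := hind.exists_isBase_superset
  have : insert e A = B := by
    refine (hB.finite.subset hIB).eq_of_subset_of_encard_le hIB ?_
    rw [hB.encard_eq_eRank, Set.encard_insert_of_notMem heA, hc]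
  rwa [this]

end Relaxation

/-! ### Inequalities and integer decomposition for base polytopes. -/

section Polytope

open Classical in
theorem sum_indicator_one {α : Type*} (F : Finset α) (B : Set α) :
    ∑ i ∈ F, B.indicator (1 : α → ℝ) i = ((F.filter (· ∈ B)).card : ℝ) := by
  simp [Set.indicator_apply, Finset.sum_boole]

variable {α : Type*} {M : Matroid α}

theorem convex_basePolytope (M : Matroid α) : Convex ℝ M.basePolytope := convex_convexHull ℝ _

theorem IsBase.indicator_mem_basePolytope {B : Set α} (hB : M.IsBase B) :
    B.indicator 1 ∈ M.basePolytope := subset_convexHull ℝ _ ⟨B, hB, rfl⟩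

theorem indicator_exchange {u L : Set α} {e b : α} (heL : e ∈ L) (heu : e ∉ u) (hbu : b ∈ u)
    (hbL : b ∉ L) : u.indicator (1 : α → ℝ) + L.indicator 1 =
      (insert e (u \ {b})).indicator 1 + (insert b (L \ {e})).indicator 1 := by
  classical
  ext i
  by_cases hie : i = e
  · subst hie
    have : i ≠ b := fun h => hbL (h ▸ heL)
    simp [heL, heu, this]
  · by_cases hib : i = b
    · subst hib
      simp [hbu, hbL, hie]
    · simp [Set.indicator_apply, hie, hib]

theorem basePolytope_nonempty (M : Matroid α) : M.basePolytope.Nonempty :=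
  let ⟨_, hB⟩ := M.exists_isBase
  ⟨_, hB.indicator_mem_basePolytope⟩

/-- The sum of the coordinates in `F`, as a linear functional. -/
def coordSum (F : Finset α) : (α → ℝ) →ₗ[ℝ] ℝ := ∑ i ∈ F, LinearMap.proj i

theorem coordSum_apply (F : Finset α) (x : α → ℝ) : coordSum F x = ∑ i ∈ F, x i := by
  simp [coordSum]

theorem le_of_mem_basePolytope {f : (α → ℝ) →ₗ[ℝ] ℝ} {c : ℝ}
    (h : ∀ B, M.IsBase B → f (B.indicator 1) ≤ c) {x : α → ℝ} (hx : x ∈ M.basePolytope) :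
    f x ≤ c :=
  convexHull_min (t := {x | f x ≤ c}) (by rintro _ ⟨B, hB, rfl⟩; exact h B hB)
    (convex_halfSpace_le f.isLinear c) hx

theorem ge_of_mem_basePolytope {f : (α → ℝ) →ₗ[ℝ] ℝ} {c : ℝ}
    (h : ∀ B, M.IsBase B → c ≤ f (B.indicator 1)) {x : α → ℝ} (hx : x ∈ M.basePolytope) :
    c ≤ f x := by
  have := le_of_mem_basePolytope (f := -f) (c := -c) (fun B hB => by simpa using h B hB) hx
  simpa using this

theorem nonneg_of_mem_basePolytope {x : α → ℝ} (hx : x ∈ M.basePolytope) (i : α) : 0 ≤ x i :=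
  ge_of_mem_basePolytope (f := LinearMap.proj i)
    (fun _ _ => Set.indicator_nonneg (fun _ _ => zero_le_one) _) hx

theorem le_one_of_mem_basePolytope {x : α → ℝ} (hx : x ∈ M.basePolytope) (i : α) : x i ≤ 1 :=
  le_of_mem_basePolytope (f := LinearMap.proj i)
    (fun B _ => Set.indicator_le' (s := B) (g := 1) (fun _ _ => le_rfl)
      (fun _ _ => zero_le_one) i) hx

variable [Fintype α]

theorem isClosed_basePolytope (M : Matroid α) : IsClosed M.basePolytope := by
  refine (Set.Finite.isCompact_convexHull ℝ ?_).isClosed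
  exact (Set.toFinite (Set.range fun B : Set α => B.indicator (1 : α → ℝ))).subset
    (fun x ⟨B, _, hx⟩ => ⟨B, hx.symm⟩)

open Classical in
theorem IsBase.card_filter {r : ℕ} (hr : M.eRank = r) {B : Set α} (hB : M.IsBase B) :
    (Finset.univ.filter (· ∈ B)).card = r := by
  have h := hB.encard_eq_eRank
  rw [hr, ← Set.Finite.cast_ncard_eq (Set.toFinite B), Set.ncard_eq_toFinset_card'] at h
  rw [← Nat.cast_inj (R := ℕ∞), ← h]
  congr 2
  ext; simp

theorem sum_eq_of_mem_basePolytope {r : ℕ} (hr : M.eRank = r) {x : α → ℝ}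
    (hx : x ∈ M.basePolytope) : ∑ i, x i = r := by
  have h : ∀ B, M.IsBase B → coordSum Finset.univ (B.indicator 1) = (r : ℝ) := fun B hB => by
    rw [coordSum_apply, sum_indicator_one, hB.card_filter hr]
  rw [← coordSum_apply]
  exact le_antisymm (le_of_mem_basePolytope (fun B hB => (h B hB).le) hx)
    (ge_of_mem_basePolytope (fun B hB => (h B hB).ge) hx)

variable {F : Finset α} {r : ℕ}

theorem eRank_relaxation {S : Set α} (hS : M.CanBeRelaxed S) :
    (M.relaxation S hS).eRank = M.eRank := by
  obtain ⟨B, hB⟩ := M.exists_isBase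
  rw [← hB.encard_eq_eRank, ← IsBase.encard_eq_eRank (M := M.relaxation S hS) (Or.inl hB)]

theorem basePolytope_subset_relaxation {S : Set α} (hS : M.CanBeRelaxed S) :
    M.basePolytope ⊆ (M.relaxation S hS).basePolytope :=
  convexHull_mono fun _ ⟨B, hB, e⟩ => ⟨B, Or.inl hB, e⟩

open Classical in
theorem CanBeRelaxed.card_filter_lt (hr : M.eRank = r) (hS : M.CanBeRelaxed (F : Set α))
    {B : Set α} (hB : M.IsBase B) : (F.filter (· ∈ B)).card < r := by
  refine lt_of_le_of_ne ((Finset.card_le_card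
    (Finset.filter_subset_filter _ (Finset.subset_univ F))).trans (hB.card_filter hr).le) ?_
  intro h
  have := Finset.eq_of_subset_of_card_le
    (Finset.filter_subset_filter (· ∈ B) (Finset.subset_univ F)) (by rw [h, hB.card_filter hr])
  refine hS.2.1 B (fun i hi => ?_) hB.encard_eq_eRank hB
  have hi' : i ∈ F.filter (· ∈ B) := by rw [this]; simpa using hi
  exact (Finset.mem_filter.1 hi').1

theorem sum_le_of_mem_basePolytope (hr : M.eRank = r) (hS : M.CanBeRelaxed (F : Set α))
    {x : α → ℝ} (hx : x ∈ M.basePolytope) : ∑ i ∈ F, x i ≤ r - 1 := by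
  rw [← coordSum_apply]
  refine le_of_mem_basePolytope (fun B hB => ?_) hx
  rw [coordSum_apply, sum_indicator_one, le_sub_iff_add_le]
  exact_mod_cast hS.card_filter_lt hr hB

open Classical in
/-- If a functional is at most `c` on the bases of `M`, then an upper bound on its excess on
subsets of the hyperplane is provided by the bases that meet the hyperplane in few elements. -/
theorem IsStressedHyperplane.mul_excess_le (hE : M.E = Set.univ) (hr : M.eRank = r)
    (hH : M.IsStressedHyperplane (F : Set α)) (f : (α → ℝ) →ₗ[ℝ] ℝ) {c : ℝ}
    (hf : ∀ B, M.IsBase B → f (B.indicator 1) ≤ c) {u : Set α} (hu : u ⊆ F)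
    (huc : u.encard = M.eRank) (k : ℕ) :
    ∀ L, M.IsBase L → (F.filter (· ∈ L)).card + k + 1 = r →
      k * (f (u.indicator 1) - c) ≤ c - f (L.indicator 1) := by
  induction k with
  | zero => intro L hL _; simpa using hf L hL
  | succ k ih =>
    intro L hL hk
    obtain ⟨e, heL, heF⟩ : ∃ e ∈ L, e ∉ F := by
      by_contra! hcon
      have : F.filter (· ∈ L) = Finset.univ.filter (· ∈ L) := by
        ext i; simpa using hcon i
      rw [this, hL.card_filter hr] at hk
      omega
    have heu : e ∉ u := fun h => heF (hu h)
    obtain ⟨b, ⟨hbu, hbL⟩, hb⟩ := hH.canBeRelaxed.2.2 L u (Or.inl hL) (Or.inr ⟨hu, huc⟩) e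
      ⟨heL, heu⟩
    obtain ⟨L₁, hL₁⟩ : ∃ L₁, L₁ = insert b (L \ {e}) := ⟨_, rfl⟩
    rw [← hL₁] at hb
    have hcount : (F.filter (· ∈ L₁)).card = (F.filter (· ∈ L)).card + 1 := by
      rw [← Finset.card_insert_of_notMem (a := b) (by simp [hbL])]
      congr 1
      ext i
      simp only [hL₁, Finset.mem_filter, Set.mem_insert_iff, Set.mem_sdiff, Set.mem_singleton_iff,
        Finset.mem_insert]
      constructor
      · rintro ⟨h1, h2 | h2⟩
        · exact Or.inl h2
        · exact Or.inr ⟨h1, h2.1⟩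
      · rintro (h | h)
        · exact ⟨h ▸ hu hbu, Or.inl h⟩
        · exact ⟨h.1, Or.inr ⟨h.2, fun h' => heF (h' ▸ h.1)⟩⟩
    -- `L₁` meets `F` in fewer than `r` elements, so it is not one of the added bases.
    have hL1 : M.IsBase L₁ := by
      refine hb.resolve_right fun ⟨h1, h2⟩ => ?_
      have h3 : F.filter (· ∈ L₁) =
          Finset.univ.filter (· ∈ L₁) := by
        ext i
        simp only [Finset.mem_filter, Finset.mem_univ, true_and, and_iff_right_iff_imp]
        exact fun hi => h1 hi
      have h4 := IsBase.card_filter (M := M.relaxation F hH.canBeRelaxed)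
        ((eRank_relaxation _).trans hr) hb
      rw [← h3] at h4
      omega
    -- The other half of the exchange is a basis of `M` too, so `f` is at most `c` on it; the excess
    -- of `u` is thus charged once more against `L`.
    have hm1 : M.IsBase (insert e (u \ {b})) := by
      refine hH.isBase_insert (Set.sdiff_subset.trans hu) ?_ (hE ▸ Set.mem_univ e) heF
      rw [Set.encard_sdiff_singleton_add_one hbu, huc]
    have h1 := ih _ hL1 (by omega)
    have h2 := congrArg f (indicator_exchange heL heu hbu hbL)
    rw [map_add, map_add, ← hL₁] at h2
    have h3 := hf _ hm1
    push_cast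
    linarith

/-- The base polytope of `M` is cut out of that of the relaxation by one inequality. -/
theorem IsStressedHyperplane.mem_basePolytope_of_sum_le (hE : M.E = Set.univ) (hr : M.eRank = r)
    (hH : M.IsStressedHyperplane (F : Set α)) {x : α → ℝ}
    (hx : x ∈ (M.relaxation F hH.canBeRelaxed).basePolytope) (hle : ∑ i ∈ F, x i ≤ r - 1) :
    x ∈ M.basePolytope := by
  classical
  by_contra hxM
  obtain ⟨f, c, hf, hfx⟩ := geometric_hahn_banach_closed_point M.convex_basePolytope
    M.isClosed_basePolytope hxM
  have hfB : ∀ B, M.IsBase B → f.toLinearMap (B.indicator 1) ≤ c :=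
    fun B hB => (hf _ hB.indicator_mem_basePolytope).le
  -- `μ` is the largest excess of `f` over `c` on `r`-subsets of `F`, or 0 if all excesses are
  -- negative or there are no such subsets.
  obtain ⟨μ, hμ0, hμu, hμL⟩ : ∃ μ : ℝ, 0 ≤ μ ∧
      (∀ u : Set α, u ⊆ F → u.encard = M.eRank → f (u.indicator 1) - c ≤ μ) ∧
      ∀ L, M.IsBase L → ∀ k : ℕ, (F.filter (· ∈ L)).card + k + 1 = r →
        k * μ ≤ c - f (L.indicator 1) := by
    by_cases h : ∃ u : Set α, u ⊆ F ∧ u.encard = M.eRank ∧ 0 ≤ f (u.indicator 1) - c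
    · obtain ⟨u₀, hu₀⟩ := h
      obtain ⟨u, ⟨hu1, hu2⟩, hmax⟩ := Set.exists_max_image
        {u : Set α | u ⊆ F ∧ u.encard = M.eRank} (fun u => f (u.indicator 1)) (Set.toFinite _)
        ⟨u₀, hu₀.1, hu₀.2.1⟩
      have := hmax u₀ ⟨hu₀.1, hu₀.2.1⟩
      refine ⟨f (u.indicator 1) - c, by linarith, fun v hv1 hv2 => ?_, fun L hL k hk => ?_⟩
      · have := hmax v ⟨hv1, hv2⟩
        linarith
      · exact hH.mul_excess_le hE hr f.toLinearMap hfB hu1 hu2 k L hL hk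
    · push Not at h
      refine ⟨0, le_rfl, fun u h1 h2 => (h u h1 h2).le, fun L hL k _ => ?_⟩
      have := hfB L hL
      simpa using this
  -- Tilting `f` by `μ` makes the bound hold on every basis of the relaxation: a basis of `M` with r
  -- - 1 - k elements in `F` has slack `k * μ`, and an added one exceeds `c` by at most `μ`. With
  -- x(F) ≤ r - 1 this yields f x ≤ c, against the separation.
  have key : (f.toLinearMap - μ • coordSum F) x ≤ c - μ * (r - 1) := by
    refine le_of_mem_basePolytope (fun B hB => ?_) hx
    rw [LinearMap.sub_apply, LinearMap.smul_apply, coordSum_apply, sum_indicator_one, smul_eq_mul]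
    rcases hB with hB | ⟨hBF, hBc⟩
    · obtain ⟨k, hk⟩ : ∃ k, r = (F.filter (· ∈ B)).card + k + 1 :=
        ⟨r - ((F.filter (· ∈ B)).card + 1), by
          have := hH.canBeRelaxed.card_filter_lt hr hB
          omega⟩
      have := hμL B hB k hk.symm
      have hk' : (r : ℝ) = (F.filter (· ∈ B)).card + k + 1 := by exact_mod_cast hk
      rw [hk']
      change f (B.indicator 1) - _ ≤ _
      linarith
    · have h3 : F.filter (· ∈ B) = Finset.univ.filter (· ∈ B) := by
        ext i
        simp only [Finset.mem_filter, Finset.mem_univ, true_and, and_iff_right_iff_imp]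
        exact fun hi => hBF hi
      have h4 := IsBase.card_filter (M := M.relaxation F hH.canBeRelaxed)
        ((eRank_relaxation _).trans hr) (Or.inr ⟨hBF, hBc⟩)
      rw [h3, h4]
      have := hμu B hBF hBc
      change f (B.indicator 1) - _ ≤ _
      linarith
  rw [LinearMap.sub_apply, LinearMap.smul_apply, coordSum_apply, smul_eq_mul] at key
  change f x - _ ≤ _ at key
  nlinarith

/-- Integer decomposition for the part of the relaxation near the relaxed hyperplane. -/
theorem IsStressedHyperplane.mem_smul_basePolytope (hE : M.E = Set.univ) (hr : M.eRank = r)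
    (hH : M.IsStressedHyperplane (F : Set α)) [DecidableEq α] (t : ℕ) : ∀ z : α → ℤ,
    (∀ i, 0 ≤ z i) → (∀ i ∈ F, z i ≤ t) → ∑ i, z i = t * r → ∑ i ∈ Fᶜ, z i ≤ t →
      (fun i => (z i : ℝ)) ∈ (t : ℝ) • (M.relaxation F hH.canBeRelaxed).basePolytope := by
  induction t with
  | zero =>
    intro z h0 _ hsum _
    have hz : ∀ i, z i = 0 := by
      have := (Finset.sum_eq_zero_iff_of_nonneg fun i _ => h0 i).1 (by simpa using hsum)
      exact fun i => this i (Finset.mem_univ i)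
    rw [Nat.cast_zero, Set.zero_smul_set (basePolytope_nonempty _)]
    ext i
    simp [hz]
  | succ t ih =>
    intro z h0 hF hsum hout
    -- `e` carries positive weight whenever anything outside `F` does, so that removing a basis
    -- through `e` keeps `z e` nonnegative.
    obtain ⟨e, heF, he⟩ : ∃ e, e ∉ F ∧ (0 < ∑ i ∈ Fᶜ, z i → 0 < z e) := by
      by_cases hpos : 0 < ∑ i ∈ Fᶜ, z i
      · obtain ⟨e, he, hlt⟩ := Finset.exists_lt_of_sum_lt (s := Fᶜ) (f := fun _ => (0 : ℤ))
          (g := z) (by simpa using hpos)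
        exact ⟨e, Finset.mem_compl.1 he, fun _ => hlt⟩
      · have : ∃ e, e ∉ F := by
          by_contra! hcon
          have hu : (F : Set α) = M.E := by rw [hE]; ext i; simpa using hcon i
          have h1 := hH.1.2
          rw [hu, eRk_ground, hr] at h1
          exact absurd (by exact_mod_cast h1 : r + 1 = r) (by omega)
        exact this.imp fun e he => ⟨he, fun h => absurd h hpos⟩
    set out := ∑ i ∈ Fᶜ, z i with hout_def
    have hout0 : 0 ≤ out := Finset.sum_nonneg fun i _ => h0 i
    -- All weight outside `F` is moved to `e`, which reduces the choice of a basis to the uniform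
    -- matroid of rank `r` on `insert e F`.
    set y : α → ℤ := fun i => if i = e then out else z i with hy
    have hye : y e = out := by simp [hy]
    have hyF : ∀ i ∈ F, y i = z i := fun i hi => by
      have : i ≠ e := fun h => heF (h ▸ hi)
      simp [hy, this]
    have hy0 : ∀ i, 0 ≤ y i := fun i => by
      by_cases h : i = e <;> simp [hy, h, hout0, h0]
    have hyt : ∀ i ∈ insert e F, y i ≤ t + 1 := by
      intro i hi
      rcases Finset.mem_insert.1 hi with rfl | hi
      · rw [hye]; exact_mod_cast hout
      · rw [hyF i hi]; exact_mod_cast hF i hi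
    have hysum : ∑ i ∈ insert e F, y i = (t + 1) * r := by
      rw [Finset.sum_insert heF, hye, Finset.sum_congr rfl hyF, add_comm, hout_def,
        Finset.sum_add_sum_compl, hsum]
      push_cast; ring
    -- The basis removed must contain every coordinate at the maximum `t + 1` and may use only
    -- positive ones. Total weight (t + 1) r with entries in [0, t + 1] forces |A| ≤ r ≤ |S|.
    set A := (insert e F).filter fun i => y i = t + 1 with hA
    set S := (insert e F).filter fun i => 0 < y i with hS
    have hAS : A ⊆ S := Finset.monotone_filter_right _ fun i _ (hi : y i = t + 1) => by omega
    have hAr : A.card ≤ r := by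
      have h1 : ∑ i ∈ A, y i ≤ ∑ i ∈ insert e F, y i :=
        Finset.sum_le_sum_of_subset_of_nonneg (Finset.filter_subset _ _) fun i _ _ => hy0 i
      rw [Finset.sum_congr rfl fun i hi => (Finset.mem_filter.1 hi).2, Finset.sum_const, hysum,
        nsmul_eq_mul, mul_comm] at h1
      exact_mod_cast le_of_mul_le_mul_left h1 (by positivity)
    have hSr : r ≤ S.card := by
      have h1 : ∑ i ∈ insert e F, y i = ∑ i ∈ S, y i := by
        refine (Finset.sum_subset (Finset.filter_subset _ _) fun i hi hi' => ?_).symm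
        by_contra hne
        exact hi' (Finset.mem_filter.2 ⟨hi, lt_of_le_of_ne (hy0 i) (Ne.symm hne)⟩)
      have h2 : ∑ i ∈ S, y i ≤ ∑ _i ∈ S, ((t : ℤ) + 1) :=
        Finset.sum_le_sum fun i hi => hyt i (Finset.filter_subset _ _ hi)
      rw [← h1, hysum, Finset.sum_const, nsmul_eq_mul, mul_comm] at h2
      exact_mod_cast le_of_mul_le_mul_right h2 (by positivity)
    obtain ⟨B, hAB, hBS, hBr⟩ := Finset.exists_subsuperset_card_eq hAS hAr hSr
    have hBe : B ⊆ insert e F := hBS.trans (Finset.filter_subset _ _)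
    have hBbase : (M.relaxation F hH.canBeRelaxed).IsBase B := by
      by_cases heB : e ∈ B
      · left
        rw [← Finset.insert_erase heB, Finset.coe_insert]
        refine hH.isBase_insert ?_ ?_ (hE ▸ Set.mem_univ e) heF
        · intro i hi
          have hi := Finset.mem_erase.1 (Finset.mem_coe.1 hi)
          exact (Finset.mem_insert.1 (hBe hi.2)).resolve_left hi.1
        · rw [Set.encard_coe_eq_coe_finsetCard, hr, ← hBr, ← Finset.card_erase_add_one heB]
          push_cast; rfl
      · right
        refine ⟨fun i hi => ?_, by rw [Set.encard_coe_eq_coe_finsetCard, hr, hBr]⟩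
        refine (Finset.mem_insert.1 (hBe hi)).resolve_left fun h => heB ?_
        rw [← h]; exact hi
    have hz' := ih (fun i => z i - if i ∈ B then 1 else 0) ?_ ?_ ?_ ?_
    · have h1 : (fun i => (z i : ℝ)) =
          (fun i => ((z i - if i ∈ B then 1 else 0 : ℤ) : ℝ)) + (B : Set α).indicator 1 := by
        ext i
        by_cases hi : i ∈ B <;> simp [hi]
      rw [h1, Nat.cast_succ, (convex_basePolytope _).add_smul (Nat.cast_nonneg t) zero_le_one,
        one_smul]
      exact Set.add_mem_add hz' hBbase.indicator_mem_basePolytope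
    · intro i
      by_cases hi : i ∈ B
      · have h1 := (Finset.mem_filter.1 (hBS hi)).2
        by_cases hie : i = e
        · subst hie
          have := he (hye ▸ h1)
          simp only [hi, if_true]; omega
        · simp only [hy, hie, if_false] at h1
          simp only [hi, if_true]; omega
      · simpa [hi] using h0 i
    · intro i hiF
      have h1 := hyt i (Finset.mem_insert_of_mem hiF)
      rw [hyF i hiF] at h1
      by_cases hi : i ∈ B
      · simp only [hi, if_true]; omega
      · have : z i ≠ t + 1 := fun h => hi (hAB (Finset.mem_filter.2
          ⟨Finset.mem_insert_of_mem hiF, by rw [hyF i hiF, h]⟩))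
        simp only [hi, if_false]; omega
    · rw [Finset.sum_sub_distrib, hsum]
      simp only [Finset.sum_boole, Finset.filter_univ_mem, hBr]
      push_cast; ring
    · rw [Finset.sum_sub_distrib, ← hout_def]
      have h2 : ∀ i ∈ Fᶜ, (0 : ℤ) ≤ if i ∈ B then 1 else 0 := fun i _ => by split_ifs <;> simp
      have h1 := hyt e (Finset.mem_insert_self _ _)
      rw [hye] at h1
      by_cases heB : e ∈ B
      · have := Finset.single_le_sum h2 (Finset.mem_compl.2 heF)
        rw [if_pos heB] at this
        omega
      · have h3 : out ≠ t + 1 := fun h => heB (hAB (Finset.mem_filter.2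
          ⟨Finset.mem_insert_self _ _, by rw [hye, h]⟩))
        have := Finset.sum_nonneg h2
        omega

end Polytope

/-! ### Lattice points of the dilated polytopes. -/

section LatticePoints

variable {α : Type*} {M : Matroid α} {F : Finset α} {r t : ℕ} {z : α → ℤ}

theorem nonneg_of_mem_smul_basePolytope
    (hz : (fun i => (z i : ℝ)) ∈ (t : ℝ) • M.basePolytope) (i : α) : 0 ≤ z i := by
  obtain ⟨x, hx, h⟩ := hz
  have h1 : (t : ℝ) * x i = z i := congrFun h i
  have h2 := nonneg_of_mem_basePolytope hx i
  have : (0 : ℝ) ≤ z i := by rw [← h1]; positivity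
  exact_mod_cast this

theorem le_of_mem_smul_basePolytope
    (hz : (fun i => (z i : ℝ)) ∈ (t : ℝ) • M.basePolytope) (i : α) : z i ≤ t := by
  obtain ⟨x, hx, h⟩ := hz
  have h1 : (t : ℝ) * x i = z i := congrFun h i
  have h2 := le_one_of_mem_basePolytope hx i
  have : (z i : ℝ) ≤ t := by
    rw [← h1]
    exact mul_le_of_le_one_right (Nat.cast_nonneg t) h2
  exact_mod_cast this

variable [Fintype α]

theorem sum_eq_of_mem_smul_basePolytope (hr : M.eRank = r)
    (hz : (fun i => (z i : ℝ)) ∈ (t : ℝ) • M.basePolytope) : ∑ i, z i = t * r := by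
  obtain ⟨x, hx, h⟩ := hz
  have h1 : ∀ i, (t : ℝ) * x i = z i := fun i => congrFun h i
  have h2 := sum_eq_of_mem_basePolytope hr hx
  have : ((∑ i, z i : ℤ) : ℝ) = t * r := by
    push_cast
    simp only [← h1, ← Finset.mul_sum, h2]
  exact_mod_cast this

theorem sum_le_of_mem_smul_basePolytope (hr : M.eRank = r) (hS : M.CanBeRelaxed (F : Set α))
    (hz : (fun i => (z i : ℝ)) ∈ (t : ℝ) • M.basePolytope) :
    ∑ i ∈ F, z i ≤ t * ((r : ℤ) - 1) := by
  obtain ⟨x, hx, h⟩ := hz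
  have h1 : ∀ i, (t : ℝ) * x i = z i := fun i => congrFun h i
  have h2 := sum_le_of_mem_basePolytope hr hS hx
  have : ((∑ i ∈ F, z i : ℤ) : ℝ) ≤ t * ((r : ℝ) - 1) := by
    push_cast
    simp only [← h1, ← Finset.mul_sum]
    gcongr
  exact_mod_cast this

theorem IsStressedHyperplane.mem_smul_basePolytope_of_sum_le (hE : M.E = Set.univ)
    (hr : M.eRank = r) (hH : M.IsStressedHyperplane (F : Set α))
    (hz : (fun i => (z i : ℝ)) ∈ (t : ℝ) • (M.relaxation F hH.canBeRelaxed).basePolytope)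
    (hle : ∑ i ∈ F, z i ≤ t * ((r : ℤ) - 1)) :
    (fun i => (z i : ℝ)) ∈ (t : ℝ) • M.basePolytope := by
  rcases Nat.eq_zero_or_pos t with rfl | ht
  · rw [Nat.cast_zero, Set.zero_smul_set (basePolytope_nonempty _)] at hz ⊢
    exact hz
  obtain ⟨x, hx, h⟩ := hz
  refine ⟨x, hH.mem_basePolytope_of_sum_le hE hr hx ?_, h⟩
  have h1 : ∀ i, (t : ℝ) * x i = z i := fun i => congrFun h i
  have h2 : ((∑ i ∈ F, z i : ℤ) : ℝ) ≤ t * ((r : ℝ) - 1) := by exact_mod_cast hle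
  push_cast at h2
  simp only [← h1, ← Finset.mul_sum] at h2
  exact le_of_mul_le_mul_left h2 (Nat.cast_pos.2 ht)

/-- With total tr, the inequality z(F) ≤ t(r - 1) fails exactly when the weight outside `F` is below
`t`; coordinates outside `F` then need no upper bound of their own. -/
theorem IsStressedHyperplane.ehrhartFunction_relaxation [DecidableEq α] (hE : M.E = Set.univ)
    (hr : M.eRank = r) (hH : M.IsStressedHyperplane (F : Set α)) (t : ℕ) :
    ehrhartFunction (M.relaxation F hH.canBeRelaxed).basePolytope t =
      ehrhartFunction M.basePolytope t +
        {z : α → ℤ | (∀ i, 0 ≤ z i) ∧ (∀ i ∈ F, z i ≤ t) ∧ ∑ i, z i = t * r ∧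
          ∑ i ∈ Fᶜ, z i < t}.ncard := by
  have hr' : (M.relaxation F hH.canBeRelaxed).eRank = r := (eRank_relaxation _).trans hr
  have hsub : {z : α → ℤ | (fun i => (z i : ℝ)) ∈ (t : ℝ) • M.basePolytope} ⊆
      {z | (fun i => (z i : ℝ)) ∈ (t : ℝ) • (M.relaxation F hH.canBeRelaxed).basePolytope} :=
    fun z hz => Set.smul_set_mono (basePolytope_subset_relaxation _) hz
  have hfin : {z : α → ℤ | (fun i => (z i : ℝ)) ∈
      (t : ℝ) • (M.relaxation F hH.canBeRelaxed).basePolytope}.Finite :=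
    (Set.finite_Icc (0 : α → ℤ) (fun _ => (t : ℤ))).subset fun z hz =>
      ⟨fun i => nonneg_of_mem_smul_basePolytope hz i, fun i => le_of_mem_smul_basePolytope hz i⟩
  rw [ehrhartFunction, ehrhartFunction, add_comm, ← Set.ncard_sdiff_add_ncard_of_subset hsub hfin]
  congr 2
  ext z
  simp only [Set.mem_sdiff, Set.mem_ofPred_eq]
  have hsplit := Finset.sum_add_sum_compl F z
  have hmul : (t : ℤ) * (r - 1) = t * r - t := by ring
  constructor
  · rintro ⟨hz, hzM⟩
    have hsum := sum_eq_of_mem_smul_basePolytope hr' hz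
    refine ⟨nonneg_of_mem_smul_basePolytope hz, fun i _ => le_of_mem_smul_basePolytope hz i,
      hsum, ?_⟩
    by_contra! hlt
    exact hzM (hH.mem_smul_basePolytope_of_sum_le hE hr hz (by linarith))
  · rintro ⟨h0, hF, hsum, hlt⟩
    refine ⟨hH.mem_smul_basePolytope hE hr t z h0 hF hsum hlt.le, fun hzM => ?_⟩
    have := sum_le_of_mem_smul_basePolytope hr hH.canBeRelaxed hzM
    linarith

end LatticePoints

end Matroid

/-! ### Counting the gained lattice points. -/

/-- The points counted by the difference of the two Ehrhart functions, after reflecting the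
coordinates in `F`, are the pairs counted in `card_filter_pairs`. -/
theorem ncard_setOf_eq_card_filter_pairs {α : Type*} [Fintype α] [DecidableEq α] (F : Finset α)
    {r : ℕ} (hr : r ≤ F.card) (t : ℕ) :
    {z : α → ℤ | (∀ i, 0 ≤ z i) ∧ (∀ i ∈ F, z i ≤ t) ∧ ∑ i, z i = t * r ∧
      ∑ i ∈ Fᶜ, z i < t}.ncard =
    (((Fintype.piFinset fun _ : {i // i ∈ F} => Finset.range (t + 1)) ×ˢ
      (Fintype.piFinset fun _ : {i // i ∉ F} => Finset.range t)).filter fun p =>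
        ∑ i, p.2 i < t ∧ ∑ i, p.1 i = t * (F.card - r) + ∑ i, p.2 i).card := by
  set ψ : ({i // i ∈ F} → ℕ) × ({i // i ∉ F} → ℕ) → α → ℤ :=
    fun p i => if h : i ∈ F then (t : ℤ) - p.1 ⟨i, h⟩ else p.2 ⟨i, h⟩ with hψ
  have hψ1 : ∀ p (i : {i // i ∈ F}), ψ p i = t - p.1 i := fun p i => by simp [hψ, i.2]
  have hψ2 : ∀ p (i : {i // i ∉ F}), ψ p i = p.2 i := fun p i => by simp [hψ, i.2]
  have hinj : Function.Injective ψ := by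
    rintro ⟨y, w⟩ ⟨y', w'⟩ h
    refine Prod.ext (funext fun i => ?_) (funext fun i => ?_)
    · have := congrFun h i
      rw [hψ1, hψ1] at this
      simp only at this ⊢; omega
    · have := congrFun h i
      rw [hψ2, hψ2] at this
      simp only at this ⊢; omega
  have hs1 : ∀ z : α → ℤ, ∑ i ∈ F, z i = ∑ i : {i // i ∈ F}, z i := fun z =>
    (Finset.sum_coe_sort F z).symm
  have hs2 : ∀ z : α → ℤ, ∑ i ∈ Fᶜ, z i = ∑ i : {i // i ∉ F}, z i := fun z =>
    Finset.sum_subtype _ (fun i => Finset.mem_compl) z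
  have hsum1 : ∀ p, ∑ i ∈ F, ψ p i = t * F.card - ((∑ i, p.1 i : ℕ) : ℤ) := fun p => by
    rw [hs1]
    simp only [hψ1, Finset.sum_sub_distrib, Finset.sum_const, Finset.card_univ,
      Fintype.card_coe, nsmul_eq_mul]
    push_cast; ring
  have hsum2 : ∀ p, ∑ i ∈ Fᶜ, ψ p i = ((∑ i, p.2 i : ℕ) : ℤ) := fun p => by
    rw [hs2]
    simp only [hψ2]
    push_cast; rfl
  have hmul : (t : ℤ) * F.card = t * r + ((t * (F.card - r) : ℕ) : ℤ) := by
    push_cast [hr]; ring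
  rw [← Set.ncard_coe_finset, ← Set.ncard_image_of_injective _ hinj]
  congr 1
  ext z
  simp only [Set.mem_ofPred_eq, Set.mem_image, Finset.coe_filter, Finset.mem_product,
    Fintype.mem_piFinset, Finset.mem_range]
  constructor
  · rintro ⟨h0, hF, hsum, hlt⟩
    have hz : ψ (fun i => (t - z i).toNat, fun i => (z i).toNat) = z := by
      ext i
      by_cases hi : i ∈ F
      · have := hF i hi
        simp only [hψ, hi, dif_pos]; omega
      · have := h0 i
        simp only [hψ, hi, dif_neg, not_false_eq_true]; omega
    refine ⟨_, ⟨⟨fun i => ?_, fun i => ?_⟩, ?_, ?_⟩, hz⟩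
    · have := h0 i
      simp only; omega
    -- A single coordinate outside `F` is at most the outside sum, hence below `t`.
    · have h1 := Finset.single_le_sum (fun i _ => h0 i) (Finset.mem_compl.2 i.2)
      have := h0 i
      simp only; omega
    · have h2 := hsum2 (fun i => (t - z i).toNat, fun i => (z i).toNat)
      rw [hz] at h2
      exact_mod_cast h2 ▸ hlt
    · have h1 := hsum1 (fun i => (t - z i).toNat, fun i => (z i).toNat)
      have h2 := hsum2 (fun i => (t - z i).toNat, fun i => (z i).toNat)
      rw [hz] at h1 h2
      have h3 := Finset.sum_add_sum_compl F z
      zify at *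
      linarith
  · rintro ⟨⟨y, w⟩, ⟨⟨hy, hw⟩, hlt, heq⟩, rfl⟩
    refine ⟨fun i => ?_, fun i hi => ?_, ?_, ?_⟩
    · by_cases hi : i ∈ F
      · have := hy ⟨i, hi⟩
        rw [hψ1 _ ⟨i, hi⟩]; simp only at this ⊢; omega
      · rw [hψ2 _ ⟨i, hi⟩]; positivity
    · rw [hψ1 _ ⟨i, hi⟩]; simp
    · rw [← Finset.sum_add_sum_compl F, hsum1, hsum2]
      simp only at heq ⊢
      rw [heq, hmul]; push_cast; ring
    · rw [hsum2]; exact_mod_cast hlt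

theorem ncard_setOf_eq_zero {α : Type*} [Fintype α] [DecidableEq α] (F : Finset α)
    {r : ℕ} (hr : F.card < r) (t : ℕ) :
    {z : α → ℤ | (∀ i, 0 ≤ z i) ∧ (∀ i ∈ F, z i ≤ t) ∧ ∑ i, z i = t * r ∧
      ∑ i ∈ Fᶜ, z i < t}.ncard = 0 := by
  convert Set.ncard_empty (α → ℤ)
  rw [Set.eq_empty_iff_forall_notMem]
  rintro z ⟨-, hF, hsum, hlt⟩
  have h1 := Finset.sum_le_sum hF
  rw [Finset.sum_const, nsmul_eq_mul] at h1
  have h2 := Finset.sum_add_sum_compl F z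
  have h3 : ((F.card : ℤ) + 1) * t ≤ r * t := by gcongr; exact_mod_cast hr
  linarith

/-! ### Evaluating the correction term, and the conclusion. -/

theorem phiTilde_of_lt {r s : ℕ} (h : s < r) (n : ℕ) : phiTilde r s n = 0 := by
  rw [phiTilde, show s + 1 - r = 0 by omega, Finset.sum_range_zero]

/-- Substituting s = d + 1 and n = s + m + 1 brings the correction into the form delivered by
`card_filter_pairs`. -/
theorem eval_correction (r d m : ℕ) (t : ℕ) :
    (C (((d + 1 + (m + 1) : ℕ) - (d + 1 : ℕ) : ℚ) / ((d + 1 + (m + 1) - 1)! : ℚ)) *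
      polyChoose (X - 1 + ((d + 1 + (m + 1) : ℕ) : ℚ[X]) - ((d + 1 : ℕ) : ℚ[X]))
        (d + 1 + (m + 1) - (d + 1)) *
      phiTilde r (d + 1) (d + 1 + (m + 1))).eval (t : ℚ) =
    ((m : ℚ) + 1) / ((m + 1 + d)! : ℚ) * Ring.choose ((t : ℚ) + m) (m + 1) *
      ∑ i ∈ Finset.range (d + 2 - r), (-1) ^ i * ((d + 1).choose i : ℚ) *
        ∑ l ∈ Finset.range (d + 1), ((m + d - l)! : ℚ) * (l ! : ℚ) *
          Ring.choose ((d : ℚ) - i + t * (d + 1 - r - i) + t - 1 - l) (d - l) *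
          Ring.choose ((d : ℚ) - i + t * (d + 1 - r - i)) l := by
  rw [eval_mul, eval_mul, eval_C, polyChoose_eval, phiTilde, eval_finsetSum,
    show d + 1 + (m + 1) - 1 = m + 1 + d by omega, show d + 1 + (m + 1) - (d + 1) = m + 1 by omega]
  congr 1
  · congr 2
    · push_cast; ring
    · simp only [eval_sub, eval_add, eval_X, eval_one, eval_natCast]
      push_cast; ring
  · refine Finset.sum_congr rfl fun i _ => ?_
    simp only [eval_mul, eval_finsetSum, polyChoose_eval, eval_sub, eval_add, eval_X, eval_one,
      eval_natCast, eval_pow, eval_neg, eval_ofNat]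
    congr 1
    refine Finset.sum_congr rfl fun l _ => ?_
    rw [show d + 1 + (m + 1) - 2 - l = m + d - l by omega, show d + 1 - 1 - l = d - l by omega]
    congr 2
    · congr 1
      push_cast; ring
    · push_cast; ring

theorem mainTheorem5 {n r s : ℕ} (M : Matroid (Fin n)) (hE : M.E = Set.univ)
    (hr : M.eRank = (r : ℕ∞)) (H : Set (Fin n)) (hH : M.IsStressedHyperplane H)
    (hs : H.ncard = s) :
    (∀ t : ℕ,
      (ehrhartFunction (M.relaxation H hH.canBeRelaxed).basePolytope t : ℚ) =
        (ehrhartFunction M.basePolytope t : ℚ) +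
          (C (((n : ℚ) - (s : ℚ)) / ((n - 1)! : ℚ)) *
            polyChoose (X - 1 + (n : ℚ[X]) - (s : ℚ[X])) (n - s) *
            phiTilde r s n).eval (t : ℚ)) ∧
    (∀ p q : ℚ[X],
      IsEhrhartPolynomial (M.relaxation H hH.canBeRelaxed).basePolytope p →
      IsEhrhartPolynomial M.basePolytope q →
      p = q + C (((n : ℚ) - (s : ℚ)) / ((n - 1)! : ℚ)) *
        polyChoose (X - 1 + (n : ℚ[X]) - (s : ℚ[X])) (n - s) * phiTilde r s n) := by
  have main : ∀ t : ℕ,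
      (ehrhartFunction (M.relaxation H hH.canBeRelaxed).basePolytope t : ℚ) =
        (ehrhartFunction M.basePolytope t : ℚ) +
          (C (((n : ℚ) - (s : ℚ)) / ((n - 1)! : ℚ)) *
            polyChoose (X - 1 + (n : ℚ[X]) - (s : ℚ[X])) (n - s) *
            phiTilde r s n).eval (t : ℚ) := by
    intro t
    obtain ⟨F, rfl⟩ : ∃ F : Finset (Fin n), (F : Set (Fin n)) = H :=
      (Set.toFinite H).exists_finset_coe
    rw [Set.ncard_coe_finset] at hs
    rw [hH.ehrhartFunction_relaxation hE hr, Nat.cast_add]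
    congr 1
    -- If s < r, there is no `r`-subset of `H` to add, and both sides vanish.
    rcases lt_or_ge s r with hsr | hrs
    · rw [phiTilde_of_lt hsr, ncard_setOf_eq_zero F (hs.trans_lt hsr)]
      simp
    have hr1 : 1 ≤ r := by
      have h1 := hH.1.2
      rw [hr] at h1
      rcases Nat.eq_zero_or_pos r with rfl | h
      · simp at h1
      · exact h
    have hsn : s < n := by
      refine lt_of_le_of_ne (by simpa [hs] using F.card_le_univ) fun h => ?_
      have hF : F = Finset.univ := Finset.card_eq_iff_eq_univ F |>.1 (by simp [hs, h])
      have h1 := hH.1.2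
      rw [hF, Finset.coe_univ, ← hE, Matroid.eRk_ground, hr] at h1
      exact absurd (by exact_mod_cast h1 : r + 1 = r) (by omega)
    obtain ⟨d, hd⟩ : ∃ d, s = d + 1 := ⟨s - 1, by omega⟩
    obtain ⟨m, hm⟩ : ∃ m, n = d + 1 + (m + 1) := ⟨n - s - 1, by omega⟩
    have hι : Fintype.card {i // i ∈ F} = d + 1 := by rw [Fintype.card_coe, hs, hd]
    have hκ : Fintype.card {i // i ∉ F} = m + 1 := by
      rw [Fintype.card_subtype_compl, hι, Fintype.card_fin]; omega
    rw [ncard_setOf_eq_card_filter_pairs F (hs ▸ hrs), hs, hd,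
      card_filter_pairs hι hκ hr1 (hd ▸ hrs), ← eval_correction]
    rw [← hm]
  refine ⟨main, fun p q hp hq => ?_⟩
  -- Two polynomials that agree at all natural numbers are equal.
  refine Polynomial.eq_of_infinite_eval_eq _ _
    ((Set.infinite_range_of_injective (Nat.cast_injective (R := ℚ))).mono ?_)
  rintro _ ⟨t, rfl⟩
  rw [Set.mem_ofPred_eq, eval_add, hp t, hq t, main t]
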